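/- Let $\mathscr H$ be a finite-dimensional complex Hilbert space, and order the self-adjoint operators (Hermitian matrices) on $\mathscr H$ by Löwner's order: $L\le A$ if and only if $(Lu,u)\le(Au,u)$ for all $u\in\mathscr H$. For positive semidefinite $A,B$ let $A:B:=A(A+B)^{\#}B$ be their parallel sum, where $^{\#}$ denotes the Moore–Penrose inverse, and put $[A]B:=\lim_{m\to\infty}(mA):B$ (this limit exists). Let $n\ge 1$, let $\mathfrak M=\{A^{(1)},\dots,A^{(n)}\}$ be a finite set of positive semidefinite operators on $\mathscr H$, and let $S:=A^{(1)}:(A^{(2)}:(\cdots:A^{(n)}))$ be the parallel sum of the operators of $\mathfrak M$. Then the set $$\mathfrak L^{+}(\mathfrak M)=\{L : L \text{ self-adjoint},\ L\ge 0,\ L\le A^{(j)} \text{ for } j=1,\dots,n\}$$ of positive lower bounds of $\mathfrak M$ has a greatest element if and only if the set $$\widetilde{\mathfrak M}=\{[S]A^{(j)} : j=1,\dots,n\}$$ has a greatest lower bound, i.e. the set of all (not necessarily positive) self-adjoint $L$ with $L\le [S]A^{(j)}$ for $j=1,\dots,n$ has a greatest element. -/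

import Mathlib

open Filter Topology

noncomputable section

namespace LoewnerOrder

set_option linter.unusedSectionVars false

variable {H : Type*} [NormedAddCommGroup H] [InnerProductSpace ℂ H] [CompleteSpace H]

/-- The self-adjoint lower bounds of a set `M` of operators. Here `L ≤ A` is the Löwner order of
Mathlib: `A - L` is a positive operator. -/
def saLowerBounds (M : Set (H →L[ℂ] H)) : Set (H →L[ℂ] H) :=
  {L | IsSelfAdjoint L ∧ ∀ A ∈ M, L ≤ A}

/-- The positive lower bounds of a set `M` of operators. -/
def posLowerBounds (M : Set (H →L[ℂ] H)) : Set (H →L[ℂ] H) :=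
  {L | L ∈ saLowerBounds M ∧ L.IsPositive}

/-- The Moore–Penrose inverse of a self-adjoint operator with finite spectrum, through the
functional calculus: the function is `x ↦ x⁻¹` with `0⁻¹ = 0`. -/
def pinv (S : H →L[ℂ] H) : H →L[ℂ] H := cfc (fun x : ℝ => x⁻¹) S

/-- The parallel sum `A : B = A (A + B)^# B`. -/
def parallelSum (A B : H →L[ℂ] H) : H →L[ℂ] H := A * pinv (A + B) * B

/-- The parallel sum `A 0 : (A 1 : (⋯ : A n))` of a nonempty finite family. -/
def parallelSumFamily : {n : ℕ} → (Fin (n + 1) → H →L[ℂ] H) → H →L[ℂ] H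
  | 0, A => A 0
  | _ + 1, A => parallelSum (A 0) (parallelSumFamily (Fin.tail A))

/-- `[A]B = lim_{m → ∞} (m A) : B`. -/
def bracket (A B : H →L[ℂ] H) : H →L[ℂ] H :=
  limUnder atTop fun m : ℕ => parallelSum (m • A) B

/-! The Moore–Penrose inverse and the limit above are what they should be in finite dimension. -/

theorem isSelfAdjoint_pinv (S : H →L[ℂ] H) : IsSelfAdjoint (pinv S) := cfc_predicate _ _

theorem mul_pinv_comm (S : H →L[ℂ] H) (hS : IsSelfAdjoint S) : S * pinv S = pinv S * S := by
  have h := cfc_commute_cfc (fun x : ℝ => x) (fun x : ℝ => x⁻¹) S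
  rw [cfc_id' ℝ S] at h
  exact h

section FiniteDimensional

variable [FiniteDimensional ℂ H]

theorem finite_spectrum (S : H →L[ℂ] H) : (spectrum ℝ S).Finite := by
  have h : (spectrum ℂ S).Finite := by
    have h1 := Module.End.finite_spectrum (S : H →ₗ[ℂ] H)
    refine h1.subset ?_
    intro z hz hu
    apply hz
    obtain ⟨u, hu⟩ := hu
    refine ⟨⟨algebraMap ℂ _ z - S, LinearMap.toContinuousLinearMap (↑u⁻¹ : H →ₗ[ℂ] H), ?_, ?_⟩, rfl⟩
    · ext x
      have := LinearMap.congr_fun u.mul_inv x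
      rw [hu] at this
      exact this
    · ext x
      have := LinearMap.congr_fun u.inv_mul x
      rw [hu] at this
      exact this
  rw [← spectrum.preimage_algebraMap (S := ℂ)]
  exact h.preimage (fun a _ b _ h => Complex.ofReal_injective h)

theorem continuousOn_spectrum (S : H →L[ℂ] H) (f : ℝ → ℝ) : ContinuousOn f (spectrum ℝ S) :=
  (finite_spectrum S).continuousOn f

theorem mul_pinv_mul (S : H →L[ℂ] H) (hS : IsSelfAdjoint S) : S * pinv S * S = S := by
  have h1 : S * pinv S = cfc (fun x : ℝ => x * x⁻¹) S := by
    rw [cfc_mul _ _ S (continuousOn_spectrum _ _) (continuousOn_spectrum _ _), cfc_id' ℝ S, pinv]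
  have h2 : S * pinv S * S = cfc (fun x : ℝ => x * x⁻¹ * x) S := by
    rw [cfc_mul _ _ S (continuousOn_spectrum _ _) (continuousOn_spectrum _ _), cfc_id' ℝ S, h1]
  rw [h2]
  simp [cfc_id' ℝ S]

theorem pinv_mul_pinv (S : H →L[ℂ] H) (hS : IsSelfAdjoint S) : pinv S * S * pinv S = pinv S := by
  have h1 : pinv S * S = cfc (fun x : ℝ => x⁻¹ * x) S := by
    rw [cfc_mul _ _ S (continuousOn_spectrum _ _) (continuousOn_spectrum _ _), cfc_id' ℝ S, pinv]
  have h2 : pinv S * S * pinv S = cfc (fun x : ℝ => x⁻¹ * x * x⁻¹) S := by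
    rw [cfc_mul _ _ S (continuousOn_spectrum _ _) (continuousOn_spectrum _ _), h1, pinv]
  rw [h2, pinv]
  congr 1
  ext x
  rcases eq_or_ne x 0 with rfl | hx
  · simp
  · field_simp

theorem mul_pinv_mul_of_le {X B : H →L[ℂ] H} (hB : B.IsPositive) (hX : X.IsPositive)
    (h : B ≤ X) : X * pinv X * B = B := by
  have hXs : IsSelfAdjoint X := hX.isSelfAdjoint
  have hker : ∀ u, X u = 0 → B u = 0 := by
    intro u hu
    have h1 : 0 ≤ (X - B).reApplyInnerSelf u := ((ContinuousLinearMap.le_def _ _).1 h).2 u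
    have h2 : 0 ≤ B.reApplyInnerSelf u := hB.2 u
    have h3 : B.reApplyInnerSelf u = 0 := by
      apply le_antisymm _ h2
      simpa [ContinuousLinearMap.reApplyInnerSelf, hu, inner_neg_left] using h1
    have hB0 : (0 : H →L[ℂ] H) ≤ B := (ContinuousLinearMap.nonneg_iff_isPositive B).2 hB
    have hs : IsSelfAdjoint (CFC.sqrt B) := (CFC.sqrt_nonneg B).isSelfAdjoint
    have h4 : ‖CFC.sqrt B u‖ ^ 2 = B.reApplyInnerSelf u := by
      rw [ContinuousLinearMap.reApplyInnerSelf]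
      conv_rhs => rw [← CFC.sqrt_mul_sqrt_self B hB0]
      rw [mul_apply_eq_comp,
        ← ContinuousLinearMap.adjoint_inner_right, ← ContinuousLinearMap.star_eq_adjoint,
        hs.star_eq, ← inner_self_eq_norm_sq (𝕜 := ℂ)]
    rw [h3] at h4
    have h5 : CFC.sqrt B u = 0 := by simpa using h4
    rw [← CFC.sqrt_mul_sqrt_self B hB0, mul_apply_eq_comp, h5, map_zero]
  have h1 : B * pinv X * X = B := by
    ext u
    have := hker (u - pinv X (X u)) (by
      have := congrArg (fun T : H →L[ℂ] H => T u) (mul_pinv_mul X hXs)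
      simp only [mul_apply_eq_comp] at this
      rw [map_sub, this, sub_self])
    rw [map_sub, sub_eq_zero] at this
    exact this.symm
  have h2 := congrArg star h1
  rw [star_mul, star_mul, hXs.star_eq, (isSelfAdjoint_pinv X).star_eq, hB.isSelfAdjoint.star_eq,
    ← mul_assoc] at h2
  exact h2

theorem mul_pinv_mul_anti {X Y B : H →L[ℂ] H} (hB : B.IsPositive) (hX : X.IsPositive)
    (hBX : B ≤ X) (hXY : X ≤ Y) : B * pinv Y * B ≤ B * pinv X * B := by
  have hX0 := (ContinuousLinearMap.nonneg_iff_isPositive X).2 hX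
  have hY : Y.IsPositive := (ContinuousLinearMap.nonneg_iff_isPositive Y).1 (hX0.trans hXY)
  have eX := mul_pinv_mul_of_le hB hX hBX
  have eY := mul_pinv_mul_of_le hB hY (hBX.trans hXY)
  have eX' := congrArg star eX
  have eY' := congrArg star eY
  simp only [star_mul, hX.isSelfAdjoint.star_eq, hY.isSelfAdjoint.star_eq,
    (isSelfAdjoint_pinv X).star_eq, (isSelfAdjoint_pinv Y).star_eq,
    hB.isSelfAdjoint.star_eq] at eX' eY'
  -- the difference is `(WX - WY)* X (WX - WY) + WY* (Y - X) WY` with `WX = X^# B`, `WY = Y^# B`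
  have key : B * pinv X * B - B * pinv Y * B =
      star (pinv X * B - pinv Y * B) * X * (pinv X * B - pinv Y * B)
        + star (pinv Y * B) * (Y - X) * (pinv Y * B) := by
    simp only [star_sub, star_mul, (isSelfAdjoint_pinv X).star_eq,
      (isSelfAdjoint_pinv Y).star_eq, hB.isSelfAdjoint.star_eq]
    have a1 : B * pinv X * X * (pinv X * B) = B * pinv X * B := by
      rw [mul_assoc B, eX', mul_assoc]
    have a2 : B * pinv X * X * (pinv Y * B) = B * pinv Y * B := by
      rw [mul_assoc B, eX', mul_assoc]
    have a3 : B * pinv Y * X * (pinv X * B) = B * pinv Y * B := by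
      rw [mul_assoc _ X, ← mul_assoc X, eX]
    have a4 : B * pinv Y * Y * (pinv Y * B) = B * pinv Y * B := by
      rw [mul_assoc B, eY', mul_assoc]
    simp only [sub_mul, mul_sub, a1, a2, a3, a4]
    abel
  rw [← sub_nonneg, key]
  exact add_nonneg (star_left_conjugate_nonneg hX0 _)
    (star_left_conjugate_nonneg (sub_nonneg.2 hXY) _)

theorem parallelSum_eq {A B : H →L[ℂ] H} (hA : A.IsPositive) (hB : B.IsPositive) :
    parallelSum A B = B - B * pinv (A + B) * B := by
  have h := mul_pinv_mul_of_le hB (hA.add hB) (by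
    have := (ContinuousLinearMap.nonneg_iff_isPositive A).2 hA
    simpa using add_le_add_left this B)
  rw [parallelSum, eq_sub_iff_add_eq, ← add_mul, ← add_mul, h]

theorem parallelSum_le {A B : H →L[ℂ] H} (hA : A.IsPositive) (hB : B.IsPositive) :
    parallelSum A B ≤ B := by
  have hX := (hA.add hB)
  have hB' := hB.isSelfAdjoint
  have hX' := hX.isSelfAdjoint
  have h0 : (0 : H →L[ℂ] H) ≤ pinv (A + B) := by
    rw [← pinv_mul_pinv _ hX']
    have := star_left_conjugate_nonneg ((ContinuousLinearMap.nonneg_iff_isPositive _).2 hX)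
      (pinv (A + B))
    rwa [(isSelfAdjoint_pinv (A + B)).star_eq] at this
  have := star_left_conjugate_nonneg h0 B
  rw [hB'.star_eq] at this
  rw [parallelSum_eq hA hB]
  exact sub_le_self _ this

theorem isPositive_parallelSum {A B : H →L[ℂ] H} (hA : A.IsPositive) (hB : B.IsPositive) :
    (parallelSum A B).IsPositive := by
  have hA0 := (ContinuousLinearMap.nonneg_iff_isPositive A).2 hA
  rw [← ContinuousLinearMap.nonneg_iff_isPositive, parallelSum_eq hA hB, sub_nonneg]
  have h := mul_pinv_mul_anti (Y := A + B) hB hB le_rfl (by simpa using add_le_add_left hA0 B)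
  rwa [mul_pinv_mul B hB.isSelfAdjoint] at h

theorem isPositive_parallelSumFamily : ∀ {n : ℕ} (A : Fin (n + 1) → H →L[ℂ] H),
    (∀ j, (A j).IsPositive) → (parallelSumFamily A).IsPositive
  | 0, _, hA => hA 0
  | _ + 1, A, hA => isPositive_parallelSum (hA 0)
      (isPositive_parallelSumFamily (Fin.tail A) fun j => hA j.succ)

/-- The limit that defines `[A]B` exists. -/
theorem tendsto_bracket {A B : H →L[ℂ] H} (hA : A.IsPositive) (hB : B.IsPositive) :
    Tendsto (fun m : ℕ => parallelSum (m • A) B) atTop (𝓝 (bracket A B)) := by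
  have hA0 := (ContinuousLinearMap.nonneg_iff_isPositive A).2 hA
  have hB0 := (ContinuousLinearMap.nonneg_iff_isPositive B).2 hB
  have hmA : ∀ m : ℕ, (m • A).IsPositive := fun m =>
    (ContinuousLinearMap.nonneg_iff_isPositive _).1 (nsmul_nonneg hA0 m)
  have hmono : Monotone fun m : ℕ => parallelSum (m • A) B := by
    intro k m hkm
    simp only [parallelSum_eq (hmA _) hB]
    refine sub_le_sub_left (mul_pinv_mul_anti hB ((hmA k).add hB) ?_ ?_) B
    · simpa using add_le_add_left (nsmul_nonneg hA0 k) B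
    · exact add_le_add_left (nsmul_le_nsmul_left hA0 hkm) B
  have : ProperSpace (H →L[ℂ] H) := FiniteDimensional.proper ℂ _
  have hmem : ∀ m : ℕ, parallelSum (m • A) B ∈ Metric.closedBall (0 : H →L[ℂ] H) ‖B‖ := by
    intro m
    rw [mem_closedBall_zero_iff]
    exact CStarAlgebra.norm_le_norm_of_nonneg_of_le
      ((ContinuousLinearMap.nonneg_iff_isPositive _).2 (isPositive_parallelSum (hmA m) hB))
      (parallelSum_le (hmA m) hB)
  have hc := isCompact_closedBall (0 : H →L[ℂ] H) ‖B‖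
  obtain ⟨T, -, φ, hφ, hT⟩ := hc.tendsto_subseq hmem
  have hub : ∀ (T : H →L[ℂ] H) (φ : ℕ → ℕ), StrictMono φ →
      Tendsto ((fun m : ℕ => parallelSum (m • A) B) ∘ φ) atTop (𝓝 T) →
      IsLUB (Set.range fun m : ℕ => parallelSum (m • A) B) T := by
    intro T φ hφ hT
    constructor
    · rintro _ ⟨m, rfl⟩
      refine ge_of_tendsto hT ?_
      filter_upwards [eventually_ge_atTop m] with k hk
      exact hmono (hk.trans (hφ.id_le k))
    · intro U hU
      exact le_of_tendsto hT (Eventually.of_forall fun k => hU ⟨_, rfl⟩)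
  refine tendsto_nhds_limUnder ⟨T, tendsto_of_subseq_tendsto fun ns hns => ?_⟩
  obtain ⟨ms, hms, hms'⟩ := strictMono_subseq_of_tendsto_atTop hns
  obtain ⟨U, -, ψ, hψ, hU⟩ := hc.tendsto_subseq (fun k => hmem (ns (ms k)))
  refine ⟨ms ∘ ψ, ?_⟩
  have hU' := hub U (ns ∘ ms ∘ ψ) (hms'.comp hψ) hU
  rw [(hub T φ hφ hT).unique hU']
  exact hU

end FiniteDimensional

end LoewnerOrder

end

open Filter Topology

namespace LoewnerOrder

section ShortedOperators

variable {H : Type*} [NormedAddCommGroup H] [InnerProductSpace ℂ H] [CompleteSpace H]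

/-! Replacing each `A j` by `[S](A j)` leaves the positive lower bounds unchanged
(`posLowerBounds_bracket`): such an `L` satisfies `L ≤ 2 ^ n • S`, so `[S]` loses nothing. It then
remains to compare positive and arbitrary lower bounds of a family vanishing on `ker S`
(`isGreatest_saLowerBounds`). A lower bound `S Z S` is at least `-c S ≥ -c G`, where `G` is the
greatest positive one, so averaging it with `G` gives a positive lower bound, whence `S Z S ≤ G`. A
general `L` is compared with `G` one vector `w` at a time, by compressing `L` with a projection
along `ker S` that fixes `w`. Conversely, `0` bounds the new family from below, so its greatest
lower bound is positive. -/

theorem isPositive_nsmul {A : H →L[ℂ] H} (hA : A.IsPositive) (m : ℕ) : (m • A).IsPositive :=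
  (ContinuousLinearMap.nonneg_iff_isPositive _).1
    (nsmul_nonneg ((ContinuousLinearMap.nonneg_iff_isPositive A).2 hA) m)

/-- A self-adjoint operator of the form `S Z S` is bounded below by a multiple of `-S`. -/
theorem exists_neg_smul_le_conjugate {S Z : H →L[ℂ] H} (hS : S.IsPositive)
    (hZ : IsSelfAdjoint Z) : ∃ c : ℝ, 0 ≤ c ∧ -(c • S) ≤ S * Z * S := by
  have hS0 := (ContinuousLinearMap.nonneg_iff_isPositive S).2 hS
  refine ⟨‖Z‖ * ‖S‖, by positivity, ?_⟩
  -- Conjugate `S ≤ ‖S‖` by the square root of `S`.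
  have h1 : S * S ≤ ‖S‖ • S := by
    have hr := CFC.sqrt_nonneg S
    have h := star_left_conjugate_le_conjugate hS.isSelfAdjoint.le_algebraMap_norm_self
      (CFC.sqrt S)
    rw [hr.isSelfAdjoint.star_eq, Algebra.algebraMap_eq_smul_one, mul_smul_comm, mul_one,
      smul_mul_assoc, CFC.sqrt_mul_sqrt_self S hS0] at h
    have e : CFC.sqrt S * S * CFC.sqrt S = S * S := by
      nth_rewrite 2 [← CFC.sqrt_mul_sqrt_self S hS0]
      rw [← mul_assoc, mul_assoc, CFC.sqrt_mul_sqrt_self S hS0]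
    rwa [e] at h
  have h2 := star_left_conjugate_le_conjugate hZ.neg_algebraMap_norm_le_self S
  rw [hS.isSelfAdjoint.star_eq, Algebra.algebraMap_eq_smul_one, mul_neg, neg_mul, mul_smul_comm,
    mul_one, smul_mul_assoc] at h2
  refine le_trans (neg_le_neg ?_) h2
  rw [mul_smul]
  exact smul_le_smul_of_nonneg_left h1 (norm_nonneg Z)

/-- Among the lower bounds that are supported on the range of `S`, the greatest positive one is
the greatest, provided it dominates `S`. -/
theorem conjugate_le_of_isGreatest {M : Set (H →L[ℂ] H)} {S G Z : H →L[ℂ] H}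
    (hS : S.IsPositive) (hSM : S ∈ posLowerBounds M) (hG : IsGreatest (posLowerBounds M) G)
    (hZ : IsSelfAdjoint Z) (hM : ∀ A ∈ M, S * Z * S ≤ A) : S * Z * S ≤ G := by
  obtain ⟨c, hc, hcL⟩ := exists_neg_smul_le_conjugate hS hZ
  have hL : IsSelfAdjoint (S * Z * S) := by
    have := hZ.conjugate S
    rwa [hS.isSelfAdjoint.star_eq] at this
  have hSG : S ≤ G := hG.2 hSM
  have hG0 := (ContinuousLinearMap.nonneg_iff_isPositive G).2 hG.1.2
  generalize S * Z * S = L at *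
  have hnn : 0 ≤ c • G + L := by
    have h := add_le_add (smul_le_smul_of_nonneg_left hSG hc) hcL
    rwa [add_neg_cancel] at h
  have hpos : 0 < c + 1 := by positivity
  -- A convex combination of the lower bounds `G` and `L`, weighted so that `L ≥ -c G` makes it
  -- positive.
  have hW : (c + 1)⁻¹ • (c • G + L) ∈ posLowerBounds M := by
    have h0 : 0 ≤ (c + 1)⁻¹ • (c • G + L) := smul_nonneg (by positivity) hnn
    refine ⟨⟨h0.isSelfAdjoint, fun A hAM => ?_⟩,
      (ContinuousLinearMap.nonneg_iff_isPositive _).1 h0⟩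
    have h := smul_le_smul_of_nonneg_left
      (add_le_add (smul_le_smul_of_nonneg_left (hG.1.1.2 A hAM) hc) (hM A hAM))
      (inv_nonneg.2 hpos.le)
    have e : (c + 1)⁻¹ • (c • A + A) = A := by
      nth_rewrite 2 [← one_smul ℝ A]
      rw [← add_smul, smul_smul, inv_mul_cancel₀ hpos.ne', one_smul]
    rwa [e] at h
  have h := smul_le_smul_of_nonneg_left (hG.2 hW) hpos.le
  rw [smul_smul, mul_inv_cancel₀ hpos.ne', one_smul, add_smul, one_smul] at h
  exact le_of_add_le_add_left h

/-! ### Order properties of parallel sums -/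

variable [FiniteDimensional ℂ H]

/-- The two sides are adjoint to each other, and a parallel sum of positive operators is
self-adjoint. -/
theorem parallelSum_comm {A B : H →L[ℂ] H} (hA : A.IsPositive) (hB : B.IsPositive) :
    parallelSum A B = parallelSum B A := by
  have h := (isPositive_parallelSum hA hB).isSelfAdjoint.star_eq
  rw [← h]
  simp only [parallelSum, star_mul, hA.isSelfAdjoint.star_eq, hB.isSelfAdjoint.star_eq,
    (isSelfAdjoint_pinv _).star_eq, mul_assoc, add_comm A B]

theorem parallelSum_mono_left {A A' B : H →L[ℂ] H} (hA : A.IsPositive) (hB : B.IsPositive)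
    (h : A ≤ A') : parallelSum A B ≤ parallelSum A' B := by
  have hA0 := (ContinuousLinearMap.nonneg_iff_isPositive A).2 hA
  have hA' := (ContinuousLinearMap.nonneg_iff_isPositive A').1 (hA0.trans h)
  rw [parallelSum_eq hA hB, parallelSum_eq hA' hB]
  exact sub_le_sub_left (mul_pinv_mul_anti hB (hA.add hB) (le_add_of_nonneg_left hA0)
    (add_le_add_left h B)) B

theorem parallelSum_mono {A A' B B' : H →L[ℂ] H} (hA : A.IsPositive) (hB : B.IsPositive)
    (h : A ≤ A') (h' : B ≤ B') : parallelSum A B ≤ parallelSum A' B' := by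
  have hA' := (ContinuousLinearMap.nonneg_iff_isPositive A').1
    (((ContinuousLinearMap.nonneg_iff_isPositive A).2 hA).trans h)
  have hB' := (ContinuousLinearMap.nonneg_iff_isPositive B').1
    (((ContinuousLinearMap.nonneg_iff_isPositive B).2 hB).trans h')
  calc parallelSum A B ≤ parallelSum A' B := parallelSum_mono_left hA hB h
    _ = parallelSum B A' := parallelSum_comm hA' hB
    _ ≤ parallelSum B' A' := parallelSum_mono_left hB hA' h'
    _ = parallelSum A' B' := parallelSum_comm hB' hA'

/-- For `X = (a + 1) L`, the identity `X X^# X = X` reads `(a + 1) L X^# L = L`. -/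
theorem parallelSum_smul_self {L : H →L[ℂ] H} (hL : IsSelfAdjoint L) {a : ℝ} (ha : 0 ≤ a) :
    parallelSum (a • L) L = (a / (a + 1)) • L := by
  have hX : IsSelfAdjoint (a • L + L) := ((IsSelfAdjoint.all a).smul hL).add hL
  have h := mul_pinv_mul _ hX
  have h1 : a • L + L = (a + 1) • L := by rw [add_smul, one_smul]
  have h2 : a + 1 ≠ 0 := by positivity
  rw [parallelSum]
  generalize pinv (a • L + L) = Y at h
  rw [h1] at h
  simp only [smul_mul_assoc, mul_smul_comm] at h ⊢
  have h3 : (a + 1) • (L * Y * L) = L := smul_right_injective _ h2 h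
  conv_rhs => rw [← h3]
  rw [smul_smul, div_mul_cancel₀ _ h2]

theorem parallelSum_self {L : H →L[ℂ] H} (hL : IsSelfAdjoint L) :
    parallelSum L L = (1 / 2 : ℝ) • L := by
  have h := parallelSum_smul_self hL (zero_le_one' ℝ)
  rw [one_smul] at h
  rw [h]
  norm_num

theorem parallelSumFamily_le : ∀ {n : ℕ} (A : Fin (n + 1) → H →L[ℂ] H),
    (∀ j, (A j).IsPositive) → ∀ j, parallelSumFamily A ≤ A j
  | 0, A, _, j => by
    obtain rfl : j = 0 := Fin.fin_one_eq_zero j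
    exact le_rfl
  | n + 1, A, hA, j => by
    have hT := isPositive_parallelSumFamily (Fin.tail A) fun j => hA j.succ
    induction j using Fin.cases with
    | zero =>
      rw [parallelSumFamily, parallelSum_comm (hA 0) hT]
      exact parallelSum_le hT (hA 0)
    | succ j =>
      exact (parallelSum_le (hA 0) hT).trans
        (parallelSumFamily_le (Fin.tail A) (fun j => hA j.succ) j)

/-- Each nested parallel sum costs a factor `1 / 2`, since `L : L = L / 2`. -/
theorem smul_le_parallelSumFamily {L : H →L[ℂ] H} (hL : L.IsPositive) :
    ∀ {n : ℕ} (A : Fin (n + 1) → H →L[ℂ] H), (∀ j, L ≤ A j) →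
      ((1 / 2 : ℝ) ^ n) • L ≤ parallelSumFamily A
  | 0, A, h => by simpa [parallelSumFamily] using h 0
  | n + 1, A, h => by
    have hL0 := (ContinuousLinearMap.nonneg_iff_isPositive L).2 hL
    have hc : ((1 / 2 : ℝ) ^ n • L).IsPositive :=
      (ContinuousLinearMap.nonneg_iff_isPositive _).1 (smul_nonneg (by positivity) hL0)
    have h0 : (1 / 2 : ℝ) ^ n • L ≤ L :=
      smul_le_of_le_one_left hL0 (pow_le_one₀ (by norm_num) (by norm_num))
    -- The first operand is also shrunk to `(1 / 2) ^ n • L`, so that both operands agree.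
    have := parallelSum_mono hc hc (h0.trans (h 0))
      (smul_le_parallelSumFamily hL (Fin.tail A) fun j => h j.succ)
    rwa [parallelSum_self hc.isSelfAdjoint, smul_smul, ← pow_succ'] at this

/-! ### The shorted operator `[A]B` -/

theorem bracket_le {A B : H →L[ℂ] H} (hA : A.IsPositive) (hB : B.IsPositive) :
    bracket A B ≤ B :=
  le_of_tendsto (tendsto_bracket hA hB)
    (Eventually.of_forall fun m => parallelSum_le (isPositive_nsmul hA m) hB)

theorem bracket_nonneg {A B : H →L[ℂ] H} (hA : A.IsPositive) (hB : B.IsPositive) :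
    0 ≤ bracket A B :=
  ge_of_tendsto (tendsto_bracket hA hB) (Eventually.of_forall fun m =>
    (ContinuousLinearMap.nonneg_iff_isPositive _).2
      (isPositive_parallelSum (isPositive_nsmul hA m) hB))

/-- `[A]B` vanishes on the kernel of `A`. -/
theorem bracket_mul_eq_zero {A B Q : H →L[ℂ] H} (hA : A.IsPositive) (hB : B.IsPositive)
    (hQ : A * Q = 0) : bracket A B * Q = 0 := by
  refine tendsto_nhds_unique ((tendsto_bracket hA hB).mul_const Q) ?_
  refine tendsto_const_nhds.congr fun m => ?_
  -- Commuting puts the factor `m • A` next to `Q`.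
  rw [parallelSum_comm (isPositive_nsmul hA m) hB, parallelSum, mul_assoc, smul_mul_assoc, hQ,
    smul_zero, mul_zero]

/-- `[A]B` dominates the positive operators below `B` that are dominated by a multiple of `A`. -/
theorem le_bracket {A B L : H →L[ℂ] H} (hA : A.IsPositive) (hB : B.IsPositive)
    (hL : L.IsPositive) {N : ℕ} (hN : 0 < N) (hLA : L ≤ N • A) (hLB : L ≤ B) :
    L ≤ bracket A B := by
  -- Along `m = k N`, `(m A) : B ≥ (k L) : L = (k / (k + 1)) L`, which tends to `L`.
  have h1 : Tendsto (fun k : ℕ => parallelSum ((k * N) • A) B) atTop (𝓝 (bracket A B)) :=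
    (tendsto_bracket hA hB).comp (tendsto_id.atTop_mul_const' hN)
  have h2 : Tendsto (fun k : ℕ => ((k : ℝ) / (k + 1)) • L) atTop (𝓝 L) := by
    simpa using (tendsto_natCast_div_add_atTop (1 : ℝ)).smul_const L
  refine le_of_tendsto_of_tendsto' h2 h1 fun k => ?_
  rw [← parallelSum_smul_self hL.isSelfAdjoint (Nat.cast_nonneg k), Nat.cast_smul_eq_nsmul]
  refine parallelSum_mono (isPositive_nsmul hL k) hL ?_ hLB
  rw [mul_smul]
  exact nsmul_le_nsmul_right hLA k

theorem posLowerBounds_bracket {n : ℕ} (A : Fin (n + 1) → H →L[ℂ] H)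
    (hA : ∀ j, (A j).IsPositive) :
    posLowerBounds (Set.range fun j => bracket (parallelSumFamily A) (A j)) =
      posLowerBounds (Set.range A) := by
  have hS := isPositive_parallelSumFamily A hA
  ext L
  simp only [posLowerBounds, saLowerBounds, Set.mem_ofPred_eq, Set.forall_mem_range]
  refine ⟨fun ⟨⟨h1, h2⟩, h3⟩ => ⟨⟨h1, fun j => (h2 j).trans (bracket_le hS (hA j))⟩, h3⟩,
    fun ⟨⟨h1, h2⟩, h3⟩ => ⟨⟨h1, fun j => ?_⟩, h3⟩⟩
  refine le_bracket hS (hA j) h3 (N := 2 ^ n) (by positivity) ?_ (h2 j)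
  have h := smul_le_smul_of_nonneg_left (smul_le_parallelSumFamily h3 A h2)
    (by positivity : (0 : ℝ) ≤ 2 ^ n)
  rw [smul_smul, ← mul_pow] at h
  rw [← Nat.cast_smul_eq_nsmul ℝ]
  simpa using h

/-- If `S` is a positive lower bound of `M` and all members of `M` vanish on the kernel of `S`, then
the greatest positive lower bound of `M` is its greatest lower bound. -/
theorem isGreatest_saLowerBounds {M : Set (H →L[ℂ] H)} (hne : M.Nonempty) {S G : H →L[ℂ] H}
    (hMsa : ∀ A ∈ M, IsSelfAdjoint A)
    (hSM : S ∈ posLowerBounds M) (hker : ∀ A ∈ M, ∀ x, S x = 0 → A x = 0)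
    (hG : IsGreatest (posLowerBounds M) G) : IsGreatest (saLowerBounds M) G := by
  refine ⟨hG.1.1, fun L ⟨hL, hLM⟩ => ?_⟩
  have hS : S.IsPositive := hSM.2
  rw [ContinuousLinearMap.le_def]
  refine ⟨(hG.1.1.1.sub hL).isSymmetric, fun w => ?_⟩
  -- The orthogonal projection onto the range of `S`.
  set P : H →L[ℂ] H := pinv S * S with hP
  have hSP : S * P = S := by rw [hP, ← mul_assoc, mul_pinv_mul S hS.isSelfAdjoint]
  have hPs : IsSelfAdjoint P := by
    rw [IsSelfAdjoint, hP, star_mul, (isSelfAdjoint_pinv S).star_eq, hS.isSelfAdjoint.star_eq,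
      mul_pinv_comm S hS.isSelfAdjoint]
  have hPP : P * P = P := by
    rw [hP, mul_assoc, ← mul_assoc S, mul_pinv_mul S hS.isSelfAdjoint]
  have hAP : ∀ A ∈ M, ∀ x, A (x - P x) = 0 := fun A hA x => hker A hA _ (by
    have := congrArg (fun T : H →L[ℂ] H => T x) hSP
    simp only [mul_apply_eq_comp] at this
    rw [map_sub, this, sub_self])
  -- `K` is an oblique projection along `ker S`, tilted so that its range contains `w`. Compression
  -- by `K` preserves every `A ∈ M`, and also the quadratic form of `L` at `w`.
  obtain ⟨K, hKw, hKP, hAK⟩ : ∃ K : H →L[ℂ] H, (P w ≠ 0 → K w = w) ∧ K * P = K ∧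
      ∀ A ∈ M, A * K = A := by
    refine ⟨P + (innerSL ℂ (P w)).smulRight (((‖P w‖ : ℂ) ^ 2)⁻¹ • (w - P w)), ?_, ?_, ?_⟩
    · intro hw
      have e : inner ℂ (P w) w = (‖P w‖ : ℂ) ^ 2 := by
        refine Eq.trans ?_ (inner_self_eq_norm_sq_to_K (𝕜 := ℂ) (P w))
        rw [← ContinuousLinearMap.adjoint_inner_left,
          ← ContinuousLinearMap.star_eq_adjoint, hPs.star_eq, ← mul_apply_eq_comp, hPP]
      have hne : (‖P w‖ : ℂ) ^ 2 ≠ 0 := by simpa using hw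
      simp [e, smul_smul, mul_inv_cancel₀ hne]
    · ext x
      have e : inner ℂ (P w) (P x) = inner ℂ (P w) x := by
        rw [← ContinuousLinearMap.adjoint_inner_left,
          ← ContinuousLinearMap.star_eq_adjoint, hPs.star_eq, ← mul_apply_eq_comp, hPP]
      have e' : P (P x) = P x := by rw [← mul_apply_eq_comp, hPP]
      simp [e, e']
    · intro A hA
      ext x
      have e := hAP A hA x
      have e' := hAP A hA w
      rw [map_sub, sub_eq_zero] at e
      simp [e', ← e, -map_sub]
  have hLK : star K * L * K = S * (pinv S * (star K * L * K) * pinv S) * S := by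
    have h1 : S * pinv S * star K = star K := by
      have := congrArg star hKP
      rwa [star_mul, hPs.star_eq, hP, ← mul_pinv_comm S hS.isSelfAdjoint] at this
    calc star K * L * K = (S * pinv S * star K) * L * (K * (pinv S * S)) := by
          rw [h1, ← hP, hKP]
      _ = _ := by simp only [mul_assoc]
  have hle : star K * L * K ≤ G := by
    rw [hLK]
    refine conjugate_le_of_isGreatest hS hSM hG ?_ fun A hA => ?_
    · have h1 : IsSelfAdjoint (star K * L * K) := hL.conjugate' K
      have h2 := h1.conjugate (pinv S)
      rwa [(isSelfAdjoint_pinv S).star_eq] at h2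
    · rw [← hLK]
      have h1 := star_left_conjugate_le_conjugate (hLM A hA) K
      have h2 : star K * A = A := by
        have := congrArg star (hAK A hA)
        rwa [star_mul, (hMsa A hA).star_eq] at this
      rwa [h2, hAK A hA] at h1
  -- If `P w = 0`, then `w ∈ ker S`, so `(L w, w) ≤ (A w, w) = 0 ≤ (G w, w)`.
  by_cases hw : P w = 0
  · obtain ⟨A, hA⟩ := hne
    have h1 := ((ContinuousLinearMap.le_def _ _).1 (hLM A hA)).2 w
    have h2 := hG.1.2.2 w
    have h3 := hAP A hA w
    rw [hw, sub_zero] at h3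
    simp only [ContinuousLinearMap.reApplyInnerSelf, sub_apply, inner_sub_left,
      map_sub, h3, inner_zero_left, map_zero] at h1 h2 ⊢
    linarith
  · have h1 := ((ContinuousLinearMap.le_def _ _).1 hle).2 w
    have e : inner ℂ ((star K * L * K) w) w = inner ℂ (L w) w := by
      rw [mul_apply_eq_comp, mul_apply_eq_comp, ContinuousLinearMap.star_eq_adjoint,
        ContinuousLinearMap.adjoint_inner_left, hKw hw]
    simp only [ContinuousLinearMap.reApplyInnerSelf, sub_apply, inner_sub_left,
      map_sub, e] at h1 ⊢
    exact h1

end ShortedOperators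

end LoewnerOrder

theorem theorem6p14 {H : Type*} [NormedAddCommGroup H] [InnerProductSpace ℂ H] [CompleteSpace H]
    [FiniteDimensional ℂ H] {n : ℕ} (A : Fin (n + 1) → H →L[ℂ] H)
    (hA : ∀ j, (A j).IsPositive) :
    (∃ G, IsGreatest (LoewnerOrder.posLowerBounds (Set.range A)) G) ↔
      ∃ G, IsGreatest (LoewnerOrder.saLowerBounds
        (Set.range fun j => LoewnerOrder.bracket (LoewnerOrder.parallelSumFamily A) (A j))) G := by
  have hS := LoewnerOrder.isPositive_parallelSumFamily A hA
  rw [← LoewnerOrder.posLowerBounds_bracket A hA]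
  refine exists_congr fun G => ⟨fun hG => ?_, fun hG => ?_⟩
  · refine LoewnerOrder.isGreatest_saLowerBounds (S := LoewnerOrder.parallelSumFamily A)
      (Set.range_nonempty _) ?_ ?_ ?_ hG
    · rintro _ ⟨j, rfl⟩
      exact (LoewnerOrder.bracket_nonneg hS (hA j)).isSelfAdjoint
    · rw [LoewnerOrder.posLowerBounds_bracket A hA]
      refine ⟨⟨hS.isSelfAdjoint, ?_⟩, hS⟩
      rintro _ ⟨j, rfl⟩
      exact LoewnerOrder.parallelSumFamily_le A hA j
    · rintro _ ⟨j, rfl⟩ x hx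
      -- `Q` is the rank-one operator `y ↦ (x, y) x`; evaluating at `x` gives a factor `‖x‖ ^ 2`, so
      -- `x = 0` is treated separately.
      have h := LoewnerOrder.bracket_mul_eq_zero hS (hA j)
        (Q := (innerSL ℂ x).smulRight x) (by ext y; simp [hx])
      have h' := congrArg (fun T : H →L[ℂ] H => T x) h
      rcases eq_or_ne x 0 with rfl | hx0
      · exact map_zero _
      · simpa [hx0] using h'
  · have h0 : 0 ≤ G := hG.2 ⟨IsSelfAdjoint.zero _, by
      rintro _ ⟨j, rfl⟩
      exact LoewnerOrder.bracket_nonneg hS (hA j)⟩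
    exact ⟨⟨hG.1, (ContinuousLinearMap.nonneg_iff_isPositive _).1 h0⟩, fun L hL => hG.2 hL.1⟩
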